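/- Let $n\ge 2$, let $B^n(x,r)$, $\overline{B}^n(x,r)$ and $S^{n-1}(x,r)$ denote the open ball, the closed ball and the sphere with centre $x$ and radius $r$ in Euclidean space $\mathbb{R}^n$, put $\mathbb{B}^n=B^n(0,1)$, and let $\rho$ be the hyperbolic distance of $\mathbb{B}^n$, given by $$\sinh^2\frac{\rho(x,y)}{2}=\frac{|x-y|^2}{(1-|x|^2)(1-|y|^2)},\qquad \rho(x,y)\ge 0,\quad x,y\in\mathbb{B}^n.$$ (i) Let $s\in(0,1)$ and $C(s)\ge 1$, and let $u:\mathbb{B}^n\to(0,\infty)$ be a continuous function that satisfies the $(s,C(s))$-Harnack inequality in $\mathbb{B}^n$, that is, $$\max_{\overline{B}^n(z,s\delta)}u\le C(s)\min_{\overline{B}^n(z,s\delta)}u\qquad\text{whenever } \delta>0 \text{ and } B^n(z,\delta)\subset\mathbb{B}^n.$$ Then for all $x,y\in\mathbb{B}^n$ $$u(x)\le C(s)^{1+t}\,u(y),\qquad t=\frac{\log\frac{1+r}{1-r}}{\log\frac{1+s}{1-s}},\qquad r=\tanh\frac{\rho(x,y)}{2}.$$ (ii) Let $u$ be a positive harmonic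 function on $\mathbb{B}^n$, $x\in\mathbb{B}^n$, $s\in(0,1)$ and $y\in S^{n-1}(x,s(1-|x|))$. Then $$u(x)\le\frac{1}{1-s^2}\left(\frac{1+s}{1-s}\right)^n u(y)\qquad\text{and}\qquad s<\exp(\rho(x,y))-1.$$ -/

import Mathlib

open Metric

/-- A continuous function `u : G → [0, ∞)` (only the values on `G` matter) satisfies the
`(s, C)`-Harnack inequality in `G`: `max u ≤ C * min u` on the closed ball of centre `x` and
radius `s * r`, whenever the open ball of centre `x` and radius `r` lies in `G`. (For `0 < s < 1`
that closed ball is a nonempty compact subset of `G`, so the supremum and the infimum are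
attained.) -/
structure SatisfiesHarnack {n : ℕ} (G : Set (EuclideanSpace ℝ (Fin n))) (s C : ℝ)
    (u : EuclideanSpace ℝ (Fin n) → ℝ) : Prop where
  continuousOn : ContinuousOn u G
  nonneg : ∀ x ∈ G, 0 ≤ u x
  sSup_le : ∀ (x : EuclideanSpace ℝ (Fin n)) (r : ℝ), 0 < r → ball x r ⊆ G →
    sSup (u '' closedBall x (s * r)) ≤ C * sInf (u '' closedBall x (s * r))

/-- The hyperbolic distance of the unit ball (curvature `-1`), for points of norm `< 1`. -/
noncomputable def hypDist {n : ℕ} (x y : EuclideanSpace ℝ (Fin n)) : ℝ :=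
  2 * Real.arsinh (‖x - y‖ / Real.sqrt ((1 - ‖x‖ ^ 2) * (1 - ‖y‖ ^ 2)))

/-- The hyperbolic distance `ρ` of the unit ball satisfies
`sinh² (ρ(x,y)/2) = |x-y|² / ((1-|x|²)(1-|y|²))`. -/
theorem sinh_sq_half_hypDist {n : ℕ} {x y : EuclideanSpace ℝ (Fin n)}
    (hx : x ∈ ball (0 : EuclideanSpace ℝ (Fin n)) 1)
    (hy : y ∈ ball (0 : EuclideanSpace ℝ (Fin n)) 1) :
    Real.sinh (hypDist x y / 2) ^ 2 = ‖x - y‖ ^ 2 / ((1 - ‖x‖ ^ 2) * (1 - ‖y‖ ^ 2)) := by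
  rw [mem_ball_zero_iff] at hx hy
  have h1 : 0 ≤ 1 - ‖x‖ ^ 2 := by nlinarith [norm_nonneg x]
  have h2 : 0 ≤ 1 - ‖y‖ ^ 2 := by nlinarith [norm_nonneg y]
  rw [hypDist, mul_div_cancel_left₀ _ two_ne_zero, Real.sinh_arsinh, div_pow,
    Real.sq_sqrt (mul_nonneg h1 h2)]

/-! (i) In the hyperboloid model the ball is a geodesic space. A closed hyperbolic ball of radius
`artanh s` lies in some `closedBall c (s * (1 - ‖c‖))`, where one use of the Harnack inequality
applies. Centring it at a midpoint covers any pair at distance at most `2 * artanh s = log ((1 + s)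
/ (1 - s))`. Cutting a geodesic into `⌈t⌉ ≤ 1 + t` such pieces gives the exponent, because `log ((1
+ r) / (1 - r))` is the hyperbolic distance.

(ii) No Poisson kernel is used: the factor `(1 - s)⁻¹ ^ (n + 1)` suffices, being at most the claimed
one. A mean value property with weight `(1 - ‖z‖²)₊` and a pointwise comparison of two such weights
(`mul_paraboloid_inv_smul_sub_le`) bound `u` near the centre of a ball by its value there.
Differentiating this bound at the centre controls every directional derivative of `u` from below,
and integrating along a radius gives the reverse comparison. The estimate for `exp ρ - 1` is a
direct computation with norms. -/

/-! ### Weighted mean value property of harmonic functions. -/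

section WeightedMeanValue

open MeasureTheory Module Laplacian
open scoped Topology

variable {E : Type*} [NormedAddCommGroup E]

/-- The truncated paraboloid `z ↦ (1 - ‖z‖²)₊`. -/
noncomputable def paraboloid (z : E) : ℝ := max 0 (1 - ‖z‖ ^ 2)

theorem paraboloid_nonneg (z : E) : 0 ≤ paraboloid z := le_max_left _ _

theorem continuous_paraboloid : Continuous (paraboloid : E → ℝ) := by
  unfold paraboloid; fun_prop

theorem paraboloid_eq_zero {z : E} (hz : 1 ≤ ‖z‖) : paraboloid z = 0 :=
  max_eq_left (by nlinarith)

theorem paraboloid_eq {z : E} (hz : ‖z‖ ≤ 1) : paraboloid z = 1 - ‖z‖ ^ 2 :=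
  max_eq_right (by nlinarith [norm_nonneg z])

variable [InnerProductSpace ℝ E]

theorem hasCompactSupport_paraboloid [FiniteDimensional ℝ E] :
    HasCompactSupport (paraboloid : E → ℝ) := by
  refine HasCompactSupport.intro (isCompact_closedBall (0 : E) 1) fun z hz ↦ ?_
  rw [mem_closedBall_zero_iff, not_le] at hz
  exact paraboloid_eq_zero hz.le

theorem hasDerivAt_max_zero_sq (t : ℝ) : HasDerivAt (fun t : ℝ ↦ max 0 t ^ 2) (2 * max 0 t) t := by
  rcases lt_trichotomy t 0 with ht | rfl | ht
  · have h : (fun t : ℝ ↦ max 0 t ^ 2) =ᶠ[𝓝 t] fun _ ↦ 0 := by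
      filter_upwards [Iio_mem_nhds ht] with a ha
      simp [max_eq_left (le_of_lt (Set.mem_Iio.1 ha))]
    rw [max_eq_left ht.le, mul_zero]
    exact (hasDerivAt_const t (0 : ℝ)).congr_of_eventuallyEq h
  · rw [max_self, mul_zero, hasDerivAt_iff_isLittleO_nhds_zero]
    simp only [zero_add, max_self, smul_zero, sub_zero, ne_eq, OfNat.ofNat_ne_zero,
      not_false_eq_true, zero_pow]
    refine Asymptotics.IsBigO.trans_isLittleO (g := fun h : ℝ ↦ h ^ 2) ?_ ?_
    · refine Asymptotics.isBigO_of_le _ fun h ↦ ?_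
      rw [norm_pow, norm_pow]
      refine pow_le_pow_left₀ (norm_nonneg _) ?_ 2
      rw [Real.norm_eq_abs, Real.norm_eq_abs, abs_of_nonneg (le_max_left _ _)]
      exact max_le (abs_nonneg h) (le_abs_self h)
    · simpa using Asymptotics.isLittleO_pow_id (𝕜 := ℝ) (n := 2) (by norm_num)
  · have h : (fun t : ℝ ↦ max 0 t ^ 2) =ᶠ[𝓝 t] fun t ↦ t ^ 2 := by
      filter_upwards [Ioi_mem_nhds ht] with a ha
      simp [max_eq_right (le_of_lt (Set.mem_Ioi.1 ha))]
    rw [max_eq_right ht.le]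
    simpa using (hasDerivAt_pow 2 t).congr_of_eventuallyEq h

/-- This motivates the weight: up to a constant, the field `paraboloid z • z` is the gradient of a
compactly supported C¹ function, so it can be integrated by parts without boundary terms. -/
theorem hasFDerivAt_paraboloid_sq (z : E) :
    HasFDerivAt (fun z : E ↦ paraboloid z ^ 2) ((-4 * paraboloid z) • innerSL ℝ z) z := by
  have h1 : HasFDerivAt (fun z : E ↦ 1 - ‖z‖ ^ 2) (-(2 • innerSL ℝ z)) z :=
    (hasStrictFDerivAt_norm_sq z).hasFDerivAt.const_sub 1
  have h2 := (hasDerivAt_max_zero_sq (1 - ‖z‖ ^ 2)).comp_hasFDerivAt z h1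
  refine h2.congr_fderiv ?_
  ext v
  simp [paraboloid]
  ring

theorem fderiv_comp_add_smul_apply {U : E → ℝ} (hU : ContDiff ℝ 2 U) (y : E) (r : ℝ) (v z : E) :
    fderiv ℝ (fun z ↦ fderiv ℝ U (y + r • z) v) z v
      = r * iteratedFDeriv ℝ 2 U (y + r • z) ![v, v] := by
  have h1 : HasFDerivAt (fun z : E ↦ y + r • z) (r • ContinuousLinearMap.id ℝ E) z :=
    ((hasFDerivAt_id z).const_smul r).const_add y
  have h2 : DifferentiableAt ℝ (fderiv ℝ U) (y + r • z) :=
    ((hU.fderiv_right (m := 1) (by norm_num)).differentiable one_ne_zero) _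
  have h3 := (h2.hasFDerivAt.comp z h1).clm_apply (hasFDerivAt_const v z)
  rw [iteratedFDeriv_two_apply]
  erw [h3.fderiv]
  simp

variable [FiniteDimensional ℝ E] [MeasurableSpace E] [BorelSpace E]

theorem integrable_paraboloid_mul {g : E → ℝ} (hg : Continuous g) :
    Integrable fun z ↦ paraboloid z * g z :=
  (continuous_paraboloid.mul hg).integrable_of_hasCompactSupport
    hasCompactSupport_paraboloid.mul_right

theorem integral_paraboloid_mul_inner_mul (v : E) {g : E → ℝ} (hg : ContDiff ℝ 1 g) :
    ∫ z : E, paraboloid z * (inner ℝ z v * g z)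
      = 4⁻¹ * ∫ z, paraboloid z ^ 2 * fderiv ℝ g z v := by
  have hd : ∀ z : E, fderiv ℝ (fun z : E ↦ paraboloid z ^ 2) z v
      = paraboloid z * (-4 * inner ℝ z v) := fun z ↦ by
    rw [(hasFDerivAt_paraboloid_sq z).fderiv]; simp; ring
  have hg' : Continuous fun z ↦ fderiv ℝ g z v :=
    (hg.continuous_fderiv one_ne_zero).clm_apply continuous_const
  have key := integral_mul_fderiv_eq_neg_fderiv_mul_of_integrable (μ := (volume : Measure E))
    (f := fun z : E ↦ paraboloid z ^ 2) (g := g) (v := v)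
    (by
      simp only [hd, mul_assoc]
      exact integrable_paraboloid_mul (by fun_prop))
    (by
      simp only [pow_two, mul_assoc]
      exact integrable_paraboloid_mul (continuous_paraboloid.mul hg'))
    (by
      simp only [pow_two, mul_assoc]
      exact integrable_paraboloid_mul (continuous_paraboloid.mul hg.continuous))
    (fun z _ ↦ (hasFDerivAt_paraboloid_sq z).differentiableAt)
    (fun z _ ↦ (hg.differentiable one_ne_zero) z)
  rw [key, ← integral_neg, ← integral_const_mul]
  refine integral_congr_ae (.of_forall fun z ↦ ?_)
  simp only [hd]
  ring

/-- Expanding `z` in an orthonormal basis and integrating each term by parts leaves `r / 4` times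
the integral of `paraboloid z ^ 2 * Δ U (y + r • z)`. With the next lemma, the weighted mean does
not depend on the radius. -/
theorem integral_paraboloid_mul_fderiv_eq_zero {U : E → ℝ} (hU : ContDiff ℝ 2 U) {y : E} {r : ℝ}
    (hr : 0 ≤ r) (hΔ : ∀ z ∈ ball y r, Δ U z = 0) :
    ∫ z : E, paraboloid z * fderiv ℝ U (y + r • z) z = 0 := by
  let b := stdOrthonormalBasis ℝ E
  have hfd : ContDiff ℝ 1 (fderiv ℝ U) := hU.fderiv_right (by norm_num)
  have hg : ∀ i, ContDiff ℝ 1 fun z : E ↦ fderiv ℝ U (y + r • z) (b i) := fun i ↦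
    (hfd.comp (contDiff_const.add (contDiff_const_smul r))).clm_apply contDiff_const
  have hsum : ∀ z : E, paraboloid z * fderiv ℝ U (y + r • z) z
      = ∑ i, paraboloid z * (inner ℝ z (b i) * fderiv ℝ U (y + r • z) (b i)) := fun z ↦ by
    rw [← Finset.mul_sum]
    congr 1
    conv_lhs => rw [← congrArg (fderiv ℝ U (y + r • z)) (b.sum_repr' z), map_sum]
    simp [real_inner_comm]
  have hint : ∀ i, Integrable fun z : E ↦ paraboloid z ^ 2 *
      fderiv ℝ (fun z ↦ fderiv ℝ U (y + r • z) (b i)) z (b i) := fun i ↦ by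
    simp only [pow_two, mul_assoc]
    exact integrable_paraboloid_mul (continuous_paraboloid.mul
      (((hg i).continuous_fderiv one_ne_zero).clm_apply continuous_const))
  simp only [hsum]
  have hint' : ∀ i, Integrable fun z : E ↦ paraboloid z *
      (inner ℝ z (b i) * fderiv ℝ U (y + r • z) (b i)) := fun i ↦
    integrable_paraboloid_mul
      ((by fun_prop : Continuous fun z : E ↦ inner ℝ z (b i)).mul (hg i).continuous)
  rw [integral_finsetSum _ fun i _ ↦ hint' i]
  simp only [integral_paraboloid_mul_inner_mul _ (hg _)]
  rw [← Finset.mul_sum, ← integral_finsetSum _ fun i _ ↦ hint i]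
  refine mul_eq_zero_of_right _ (integral_eq_zero_of_ae (.of_forall fun z ↦ ?_))
  simp only [fderiv_comp_add_smul_apply hU, Pi.zero_apply]
  rw [← Finset.mul_sum, ← Finset.mul_sum]
  rcases le_or_gt 1 ‖z‖ with hz | hz
  · simp [paraboloid_eq_zero hz]
  -- For `r = 0` the ball is empty and says nothing about `Δ U y`; the factor `r` from the chain
  -- rule vanishes instead.
  rcases hr.eq_or_lt with rfl | hr
  · simp
  have h := hΔ (y + r • z) (by
    rw [mem_ball, dist_eq_norm, add_sub_cancel_left, norm_smul, Real.norm_of_nonneg hr.le]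
    nlinarith)
  rw [InnerProductSpace.laplacian_eq_iteratedFDeriv_orthonormalBasis U b] at h
  simp [h]

theorem hasDerivAt_integral_paraboloid_mul {U : E → ℝ} (hU : ContDiff ℝ 1 U)
    (hc : HasCompactSupport U) (y : E) (r : ℝ) :
    HasDerivAt (fun r : ℝ ↦ ∫ z : E, paraboloid z * U (y + r • z))
      (∫ z : E, paraboloid z * fderiv ℝ U (y + r • z) z) r := by
  obtain ⟨K, hK⟩ := (hc.fderiv (𝕜 := ℝ)).exists_bound_of_continuous
    (hU.continuous_fderiv one_ne_zero)
  have hcU := hU.continuous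
  have hcf := hU.continuous_fderiv one_ne_zero
  have hint : ∀ r : ℝ, Integrable fun z : E ↦ paraboloid z * U (y + r • z) := fun r ↦
    integrable_paraboloid_mul (by fun_prop)
  have hint' : Integrable fun z : E ↦ paraboloid z * fderiv ℝ U (y + r • z) z :=
    integrable_paraboloid_mul (by fun_prop)
  refine (hasDerivAt_integral_of_dominated_loc_of_deriv_le (s := Set.univ)
    (F := fun r z ↦ paraboloid z * U (y + r • z))
    (F' := fun r z ↦ paraboloid z * fderiv ℝ U (y + r • z) z)
    (bound := fun z : E ↦ paraboloid z * (K * ‖z‖)) Filter.univ_mem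
    (.of_forall fun r ↦ (hint r).aestronglyMeasurable) (hint r) hint'.aestronglyMeasurable
    (.of_forall fun z r _ ↦ ?_) (integrable_paraboloid_mul (by fun_prop))
    (.of_forall fun z r _ ↦ ?_)).2
  · rw [norm_mul, Real.norm_of_nonneg (paraboloid_nonneg z)]
    exact mul_le_mul_of_nonneg_left ((fderiv ℝ U (y + r • z)).le_of_opNorm_le (hK _) z)
      (paraboloid_nonneg z)
  · have h1 : HasDerivAt (fun r : ℝ ↦ y + r • z) z r := by
      simpa using ((hasDerivAt_id r).smul_const z).const_add y
    exact (((hU.differentiable one_ne_zero) _).hasFDerivAt.comp_hasDerivAt r h1).const_mul _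

/-- The mean value property of harmonic functions on balls, with weight `(1 - ‖z‖²)₊`. -/
theorem integral_paraboloid_mul_eq {U : E → ℝ} (hU : ContDiff ℝ 2 U)
    (hc : HasCompactSupport U) {y : E} {ρ : ℝ} (hρ : 0 ≤ ρ) (hΔ : ∀ z ∈ ball y ρ, Δ U z = 0) :
    ∫ z : E, paraboloid z * U (y + ρ • z) = (∫ z : E, paraboloid z) * U y := by
  have hd := hasDerivAt_integral_paraboloid_mul (hU.of_le (by norm_num)) hc y
  have h := constant_of_derivWithin_zero (a := 0) (b := ρ)
    (fun r _ ↦ (hd r).differentiableAt.differentiableWithinAt) (fun r hr ↦ by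
      rw [(hd r).hasDerivWithinAt.derivWithin
        (uniqueDiffOn_Icc (hr.1.trans_lt hr.2) r ⟨hr.1, hr.2.le⟩)]
      exact integral_paraboloid_mul_fderiv_eq_zero hU hr.1
        fun z hz ↦ hΔ z (ball_subset_ball hr.2.le hz)) ρ ⟨hρ, le_rfl⟩
  rw [h]
  simp [integral_mul_const]

theorem integral_paraboloid_pos : 0 < ∫ z : E, paraboloid z := by
  refine continuous_paraboloid.integral_pos_of_hasCompactSupport_nonneg_nonzero
    hasCompactSupport_paraboloid paraboloid_nonneg (x := 0) ?_
  simp [paraboloid]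

theorem integral_paraboloid_inv_smul_mul {U : E → ℝ} (hU : ContDiff ℝ 2 U)
    (hc : HasCompactSupport U) {y : E} {ρ : ℝ} (hρ : 0 < ρ) (hΔ : ∀ z ∈ ball y ρ, Δ U z = 0) :
    ∫ w : E, paraboloid (ρ⁻¹ • (w - y)) * U w
      = ρ ^ finrank ℝ E * ((∫ z : E, paraboloid z) * U y) := by
  rw [← integral_paraboloid_mul_eq hU hc hρ.le hΔ, ← smul_eq_mul,
    ← Measure.integral_comp_inv_smul_of_nonneg volume _ hρ.le,
    ← integral_sub_right_eq_self (fun w ↦ paraboloid (ρ⁻¹ • w) * U (y + ρ • ρ⁻¹ • w)) y]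
  refine integral_congr_ae (.of_forall fun w ↦ ?_)
  simp [smul_smul, hρ.ne']

end WeightedMeanValue

/-! ### Harnack's inequality for nonnegative harmonic functions. -/

section HarmonicHarnack

open MeasureTheory Module Laplacian InnerProductSpace
open scoped Topology

/-- By the triangle inequality the worst case is `‖w - y‖ = ‖w - x‖ + dist x y`, where the
difference of the two sides is a nonnegative multiple of `(r - ‖w - x‖) ^ 2`. -/
theorem mul_paraboloid_inv_smul_sub_le {E : Type*} [NormedAddCommGroup E] [NormedSpace ℝ E]
    {x y : E} {r ρ : ℝ} (hr : 0 < r) (hρ : r + dist x y = ρ) (w : E) :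
    r * paraboloid (r⁻¹ • (w - x)) ≤ ρ * paraboloid (ρ⁻¹ • (w - y)) := by
  have hρ0 : 0 < ρ := by linarith [dist_nonneg (x := x) (y := y)]
  rcases le_or_gt 1 ‖r⁻¹ • (w - x)‖ with h | h
  · rw [paraboloid_eq_zero h, mul_zero]
    exact mul_nonneg hρ0.le (paraboloid_nonneg _)
  have h1 : ‖w - y‖ ≤ ‖w - x‖ + dist x y := by
    rw [dist_eq_norm]; exact norm_sub_le_norm_sub_add_norm_sub _ _ _
  have hsc : ∀ (t : ℝ) (v : E), 0 < t → ‖t⁻¹ • v‖ = ‖v‖ / t := fun t v ht ↦ by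
    rw [norm_smul, norm_inv, Real.norm_of_nonneg ht.le, inv_mul_eq_div]
  have hp : ‖w - x‖ < r := by rwa [hsc _ _ hr, div_lt_one hr] at h
  have hq : ‖w - y‖ < ρ := by linarith
  rw [paraboloid_eq h.le, paraboloid_eq (by rw [hsc _ _ hρ0, div_le_one hρ0]; exact hq.le),
    hsc _ _ hr, hsc _ _ hρ0]
  have hq0 := norm_nonneg (w - y)
  have hd0 := dist_nonneg (x := x) (y := y)
  have h2 : ρ - (‖w - x‖ + dist x y) ^ 2 / ρ ≤ ρ * (1 - (‖w - y‖ / ρ) ^ 2) := by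
    have : ρ * (1 - (‖w - y‖ / ρ) ^ 2) = ρ - ‖w - y‖ ^ 2 / ρ := by field_simp
    rw [this]
    gcongr
  refine le_trans ?_ h2
  have h3 : ρ - (‖w - x‖ + dist x y) ^ 2 / ρ - r * (1 - (‖w - x‖ / r) ^ 2)
      = dist x y * (r - ‖w - x‖) ^ 2 / (r * ρ) := by
    subst hρ
    field_simp
    ring
  have h4 : 0 ≤ dist x y * (r - ‖w - x‖) ^ 2 / (r * ρ) := by positivity
  linarith

/-- Multiplying by a bump function makes the integrals over the whole space available; the gap `ρ <
R` leaves room for the cutoff. -/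
theorem exists_contDiff_hasCompactSupport_eqOn {E : Type*} [NormedAddCommGroup E]
    [InnerProductSpace ℝ E] [FiniteDimensional ℝ E] {u : E → ℝ} {y : E} {ρ R : ℝ} (hρ : 0 < ρ)
    (hR : ρ < R) (hu : HarmonicOnNhd u (ball y R)) (hpos : ∀ z ∈ ball y R, 0 ≤ u z) :
    ∃ U : E → ℝ, ContDiff ℝ 2 U ∧ HasCompactSupport U ∧ (∀ z, 0 ≤ U z) ∧
      (∀ z ∈ ball y ρ, U z = u z) ∧ ∀ z ∈ ball y ρ, Δ U z = 0 := by
  let χ : ContDiffBump y := ⟨ρ, (ρ + R) / 2, hρ, by linarith⟩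
  have hout : χ.rOut < R := by change (ρ + R) / 2 < R; linarith
  refine ⟨fun z ↦ χ z * u z, contDiff_iff_contDiffAt.2 fun z ↦ ?_, χ.hasCompactSupport.mul_right,
    fun z ↦ ?_, fun z hz ↦ ?_, fun z hz ↦ ?_⟩
  · rcases lt_or_ge (dist z y) R with h | h
    · exact χ.contDiffAt.mul (hu z h).1
    · have hz : z ∉ tsupport χ := by
        rw [χ.tsupport_eq, mem_closedBall, not_le]; linarith
      refine (contDiffAt_const (c := (0 : ℝ))).congr_of_eventuallyEq ?_
      filter_upwards [notMem_tsupport_iff_eventuallyEq.1 hz] with w hw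
      simp [hw]
  · rcases lt_or_ge (dist z y) R with h | h
    · exact mul_nonneg χ.nonneg (hpos z h)
    · simp only [χ.zero_of_le_dist (hout.le.trans h), zero_mul, le_refl]
  · simp only [χ.one_of_mem_closedBall (ball_subset_closedBall hz), one_mul]
  · have h : (fun z ↦ χ z * u z) =ᶠ[𝓝 z] u := by
      filter_upwards [χ.eventuallyEq_one_of_mem_ball hz] with w hw
      simp [hw]
    rw [(laplacian_congr_nhds h).self_of_nhds]
    exact (hu z (ball_subset_ball hR.le hz)).2.self_of_nhds

variable {E : Type*} [NormedAddCommGroup E] [InnerProductSpace ℝ E] [FiniteDimensional ℝ E]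
  {u : E → ℝ} {x y : E} {ρ R : ℝ}

/-- Comparison of the values of a nonnegative harmonic function at the centre of a ball and at
another point of it. -/
theorem HarmonicOnNhd.sub_dist_pow_mul_le (hu : HarmonicOnNhd u (ball y R))
    (hpos : ∀ z ∈ ball y R, 0 ≤ u z) (hR : ρ < R) (hx : dist x y < ρ) :
    (ρ - dist x y) ^ (finrank ℝ E + 1) * u x ≤ ρ ^ (finrank ℝ E + 1) * u y := by
  borelize E
  have hρ : 0 < ρ := dist_nonneg.trans_lt hx
  obtain ⟨r, hr⟩ : ∃ r, r + dist x y = ρ := ⟨ρ - dist x y, by ring⟩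
  have hr0 : 0 < r := by linarith
  obtain ⟨U, hU, hc, hU0, hUu, hΔ⟩ := exists_contDiff_hasCompactSupport_eqOn hρ hR hu hpos
  have hsub : ball x r ⊆ ball y ρ := ball_subset_ball' hr.le
  have h1 := integral_paraboloid_inv_smul_mul hU hc hr0 fun z hz ↦ hΔ z (hsub hz)
  have h2 := integral_paraboloid_inv_smul_mul hU hc hρ hΔ
  have hint : ∀ (t : ℝ) (z : E),
      Integrable fun w : E ↦ t * (paraboloid (t⁻¹ • (w - z)) * U w) := fun t z ↦ by
    have hcont : Continuous fun w : E ↦ paraboloid (t⁻¹ • (w - z)) :=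
      continuous_paraboloid.comp (by fun_prop)
    exact ((hcont.mul hU.continuous).integrable_of_hasCompactSupport hc.mul_left).const_mul t
  have h3 := integral_mono (hint r x) (hint ρ y) fun w ↦ by
    simpa only [mul_assoc] using
      mul_le_mul_of_nonneg_right (mul_paraboloid_inv_smul_sub_le hr0 hr w) (hU0 w)
  rw [integral_const_mul, integral_const_mul, h1, h2, hUu x hx, hUu y (mem_ball_self hρ)] at h3
  have h4 := integral_paraboloid_pos (E := E)
  rw [show ρ - dist x y = r by linarith]
  refine le_of_mul_le_mul_left ?_ h4
  calc _ = _ := by ring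
    _ ≤ _ := h3
    _ = _ := by ring

/-- The derivative estimate behind Harnack's inequality. -/
theorem HarmonicOnNhd.neg_fderiv_le (hu : HarmonicOnNhd u (ball y R))
    (hpos : ∀ z ∈ ball y R, 0 ≤ u z) (hR : 0 < R) {e : E} (he : ‖e‖ = 1) :
    -((finrank ℝ E + 1) * u y) ≤ R * fderiv ℝ u y e := by
  have key : ∀ ρ ∈ Set.Ioo 0 R, -((finrank ℝ E + 1) * u y) ≤ ρ * fderiv ℝ u y e := by
    rintro ρ ⟨hρ, hρR⟩
    set N := finrank ℝ E
    -- The comparison above says `H h ≤ H 0` for small `h > 0`, so `H` has nonpositive derivative at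
    -- `0`. Moving along `-e` yields a lower bound in direction `e`.
    let H : ℝ → ℝ := fun h ↦ (ρ - h) ^ (N + 1) * u (y + (-h) • e)
    have hline : HasDerivAt (fun h : ℝ ↦ y + (-h) • e) (-e) 0 := by
      simpa using ((hasDerivAt_id (0 : ℝ)).neg.smul_const e).const_add y
    have hu' : HasFDerivAt u (fderiv ℝ u y) (y + (-(0 : ℝ)) • e) := by
      simpa using ((hu y (mem_ball_self hR)).1.differentiableAt two_ne_zero).hasFDerivAt
    have hH : HasDerivAt H (-((N + 1) * ρ ^ N) * u y - ρ ^ (N + 1) * fderiv ℝ u y e) 0 := by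
      have h1 := (((hasDerivAt_id (0 : ℝ)).const_sub ρ).pow (N + 1)).mul
        (hu'.comp_hasDerivAt (0 : ℝ) hline)
      refine h1.congr_deriv ?_
      simp
      ring
    have hle : -((N + 1) * ρ ^ N) * u y - ρ ^ (N + 1) * fderiv ℝ u y e ≤ 0 := by
      have h1 := (hasDerivAt_iff_tendsto_slope.1 hH).mono_left
        (nhdsWithin_mono 0 fun h (hh : h ∈ Set.Ioi (0 : ℝ)) ↦ ne_of_gt hh)
      refine le_of_tendsto h1 ?_
      filter_upwards [Ioo_mem_nhdsGT hρ] with h hh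
      have hd : dist (y + (-h) • e) y = h := by
        rw [dist_eq_norm, add_sub_cancel_left, norm_smul, he, norm_neg, mul_one,
          Real.norm_of_nonneg hh.1.le]
      have h2 := HarmonicOnNhd.sub_dist_pow_mul_le hu hpos hρR (x := y + (-h) • e)
        (by rw [hd]; exact hh.2)
      rw [hd] at h2
      rw [slope_def_field, sub_zero]
      refine div_nonpos_of_nonpos_of_nonneg ?_ hh.1.le
      simpa [H] using h2
    have hp : 0 < ρ ^ N := pow_pos hρ N
    have : ρ ^ N * (-((N + 1) * u y)) ≤ ρ ^ N * (ρ * fderiv ℝ u y e) := by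
      rw [pow_succ] at hle; linarith
    exact le_of_mul_le_mul_left this hp
  have hlim : Filter.Tendsto (fun ρ : ℝ ↦ ρ * fderiv ℝ u y e) (𝓝[<] R)
      (𝓝 (R * fderiv ℝ u y e)) :=
    ((continuous_id.mul continuous_const).tendsto R).mono_left nhdsWithin_le_nhds
  refine ge_of_tendsto hlim ?_
  filter_upwards [Ioo_mem_nhdsLT hR] with ρ hρ using key ρ hρ

/-- Harnack's inequality between the centre of a ball and the points of a concentric sphere. -/
theorem HarmonicOnNhd.one_sub_pow_mul_le (hu : HarmonicOnNhd u (ball x R))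
    (hpos : ∀ z ∈ ball x R, 0 ≤ u z) (hR : 0 < R) {s : ℝ} (hs : 0 ≤ s) (hs1 : s < 1)
    (hy : dist y x = s * R) :
    (1 - s) ^ (finrank ℝ E + 1) * u x ≤ u y := by
  set N := finrank ℝ E
  rcases hs.eq_or_lt with rfl | hs
  · rw [zero_mul, dist_eq_zero] at hy
    simp [hy]
  set e : E := (s * R)⁻¹ • (y - x)
  have hsR : 0 < s * R := mul_pos hs hR
  have he : ‖e‖ = 1 := by
    rw [norm_smul, norm_inv, Real.norm_of_nonneg hsR.le, ← dist_eq_norm, hy,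
      inv_mul_cancel₀ hsR.ne']
  have hball : ∀ t, 0 ≤ t → ball (x + t • e) (R - t) ⊆ ball x R := fun t ht ↦ by
    refine ball_subset_ball' (le_of_eq ?_)
    rw [dist_eq_norm, add_sub_cancel_left, norm_smul, he, Real.norm_of_nonneg ht]
    ring
  have hmem : ∀ t, 0 ≤ t → t < R → x + t • e ∈ ball x R := fun t ht htR ↦
    hball t ht (mem_ball_self (by linarith))
  have hder : ∀ t, 0 ≤ t → t < R →
      HasDerivAt (fun t : ℝ ↦ u (x + t • e)) (fderiv ℝ u (x + t • e) e) t := fun t ht htR ↦ by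
    have h1 : HasDerivAt (fun t : ℝ ↦ x + t • e) e t := by
      simpa using ((hasDerivAt_id t).smul_const e).const_add x
    exact ((hu _ (hmem t ht htR)).1.differentiableAt two_ne_zero).hasFDerivAt.comp_hasDerivAt t h1
  -- The derivative estimate in the ball of centre `x + t • e` and radius `R - t` says exactly that
  -- `g` is nondecreasing.
  let g : ℝ → ℝ := fun t ↦ u (x + t • e) / (R - t) ^ (N + 1)
  have hg : ∀ t ∈ Set.Icc 0 (s * R), HasDerivAt g
      ((fderiv ℝ u (x + t • e) e * (R - t) ^ (N + 1)
        - u (x + t • e) * (-((N + 1) * (R - t) ^ N))) / ((R - t) ^ (N + 1)) ^ 2) t := by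
    rintro t ⟨h0, h1⟩
    have htR : t < R := by nlinarith
    refine (((hder t h0 htR).div (((hasDerivAt_id t).const_sub R).pow (N + 1))
      (pow_ne_zero _ (sub_ne_zero.2 htR.ne')))).congr_deriv ?_
    simp
  have hmono : MonotoneOn g (Set.Icc 0 (s * R)) := by
    refine monotoneOn_of_deriv_nonneg (convex_Icc _ _)
      (fun t ht ↦ (hg t ht).continuousAt.continuousWithinAt)
      (fun t ht ↦ (hg t (interior_subset ht)).differentiableAt.differentiableWithinAt)
      fun t ht ↦ ?_
    have ht' := interior_subset ht
    have htR : 0 < R - t := by nlinarith [ht'.2]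
    rw [(hg t ht').deriv]
    have h1 := HarmonicOnNhd.neg_fderiv_le (hu.mono (hball t ht'.1))
      (fun z hz ↦ hpos z (hball t ht'.1 hz)) htR he
    have h2 : 0 < (R - t) ^ N := pow_pos htR N
    refine div_nonneg ?_ (sq_nonneg _)
    rw [pow_succ]
    nlinarith
  have h := hmono ⟨le_rfl, hsR.le⟩ ⟨hsR.le, le_rfl⟩ hsR.le
  have hxy : x + (s * R) • e = y := by
    simp only [e, smul_smul, mul_inv_cancel₀ hsR.ne', one_smul, add_sub_cancel]
  simp only [g, hxy, zero_smul, add_zero, sub_zero] at h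
  rw [show R - s * R = R * (1 - s) by ring, mul_pow] at h
  have hRN : 0 < R ^ (N + 1) := pow_pos hR _
  have hsN : 0 < (1 - s) ^ (N + 1) := pow_pos (by linarith) _
  rw [div_le_div_iff₀ hRN (mul_pos hRN hsN)] at h
  refine le_of_mul_le_mul_left ?_ hRN
  linarith

end HarmonicHarnack

/-! ### Geometry of the hyperbolic distance. -/

section HyperbolicDistance

open Real

variable {n : ℕ} {x y m : EuclideanSpace ℝ (Fin n)}

theorem one_sub_norm_sq_pos {x : EuclideanSpace ℝ (Fin n)} (hx : x ∈ ball 0 1) :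
    0 < 1 - ‖x‖ ^ 2 := by
  rw [mem_ball_zero_iff] at hx
  nlinarith [norm_nonneg x]

theorem hypDist_nonneg (x y : EuclideanSpace ℝ (Fin n)) : 0 ≤ hypDist x y :=
  mul_nonneg zero_le_two (arsinh_nonneg_iff.2 (by positivity))

theorem hypDist_comm (x y : EuclideanSpace ℝ (Fin n)) : hypDist x y = hypDist y x := by
  rw [hypDist, hypDist, norm_sub_rev, mul_comm (1 - ‖x‖ ^ 2)]

theorem hypDist_self (x : EuclideanSpace ℝ (Fin n)) : hypDist x x = 0 := by simp [hypDist]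

theorem eq_of_hypDist_eq_zero (hx : x ∈ ball 0 1) (hy : y ∈ ball 0 1) (h : hypDist x y = 0) :
    x = y := by
  have h1 := sinh_sq_half_hypDist hx hy
  have h2 := mul_pos (one_sub_norm_sq_pos hx) (one_sub_norm_sq_pos hy)
  rw [h, zero_div, sinh_zero, zero_pow two_ne_zero, eq_comm, div_eq_zero_iff,
    or_iff_left h2.ne', sq_eq_zero_iff, norm_eq_zero, sub_eq_zero] at h1
  exact h1

theorem cosh_eq_one_add_two_mul_sinh_half_sq (t : ℝ) : cosh t = 1 + 2 * sinh (t / 2) ^ 2 := by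
  conv_lhs => rw [← mul_div_cancel₀ t two_ne_zero, cosh_two_mul, cosh_sq]
  ring

theorem cosh_hypDist (hx : x ∈ ball 0 1) (hy : y ∈ ball 0 1) :
    cosh (hypDist x y) = ((1 + ‖x‖ ^ 2) * (1 + ‖y‖ ^ 2) - 4 * inner ℝ x y)
      / ((1 - ‖x‖ ^ 2) * (1 - ‖y‖ ^ 2)) := by
  have h1 := sinh_sq_half_hypDist hx hy
  have hx' := one_sub_norm_sq_pos hx
  have hy' := one_sub_norm_sq_pos hy
  rw [cosh_eq_one_add_two_mul_sinh_half_sq, h1, norm_sub_sq_real]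
  field_simp
  ring

theorem eq_hypDist_of_cosh_eq {d : ℝ} (hd : 0 ≤ d) (h : cosh (hypDist x y) = cosh d) :
    hypDist x y = d :=
  cosh_injOn (hypDist_nonneg x y) hd h

/-- Stereographic projection from the hyperboloid to the unit ball. -/
theorem inv_smul_mem_ball_and_cosh_hypDist {p₀ : ℝ} {p : EuclideanSpace ℝ (Fin n)} (hp₀ : 0 < p₀)
    (hp : p₀ ^ 2 - ‖p‖ ^ 2 = 1) :
    (1 + p₀)⁻¹ • p ∈ ball (0 : EuclideanSpace ℝ (Fin n)) 1 ∧
      ∀ x ∈ ball (0 : EuclideanSpace ℝ (Fin n)) 1, cosh (hypDist x ((1 + p₀)⁻¹ • p))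
        = ((1 + ‖x‖ ^ 2) * p₀ - 2 * inner ℝ x p) / (1 - ‖x‖ ^ 2) := by
  have hnorm : ‖(1 + p₀)⁻¹ • p‖ = ‖p‖ / (1 + p₀) := by
    rw [norm_smul, norm_inv, Real.norm_of_nonneg (by linarith), inv_mul_eq_div]
  have hmem : (1 + p₀)⁻¹ • p ∈ ball (0 : EuclideanSpace ℝ (Fin n)) 1 := by
    rw [mem_ball_zero_iff, hnorm, div_lt_one (by linarith)]
    nlinarith [norm_nonneg p]
  refine ⟨hmem, fun x hx ↦ ?_⟩
  have hx' := one_sub_norm_sq_pos hx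
  have h1 : 1 - (‖p‖ / (1 + p₀)) ^ 2 = 2 / (1 + p₀) := by
    have : ‖p‖ ^ 2 = p₀ ^ 2 - 1 := by linarith
    rw [div_pow, this]
    field_simp
    ring
  have h2 : 1 + (‖p‖ / (1 + p₀)) ^ 2 = 2 * p₀ / (1 + p₀) := by
    have : 2 * p₀ / (1 + p₀) = 2 - 2 / (1 + p₀) := by field_simp; ring
    rw [this]; linarith
  rw [cosh_hypDist hx hmem, hnorm, h1, h2, real_inner_smul_right]
  field_simp
  ring

/-- The unit ball with the hyperbolic distance is a geodesic space. -/
theorem exists_hypDist_eq_and_hypDist_eq_sub (hx : x ∈ ball 0 1) (hy : y ∈ ball 0 1) {d : ℝ}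
    (hd : 0 ≤ d) (hdρ : d ≤ hypDist x y) :
    ∃ z ∈ ball (0 : EuclideanSpace ℝ (Fin n)) 1,
      hypDist x z = d ∧ hypDist z y = hypDist x y - d := by
  rcases (hypDist_nonneg x y).eq_or_lt with h0 | h0
  · have : d = 0 := by linarith
    exact ⟨x, hx, by rw [hypDist_self, this], by rw [this, sub_zero]⟩
  have hK := cosh_hypDist hx hy
  have ha := one_sub_norm_sq_pos hx
  have hb := one_sub_norm_sq_pos hy
  set ρ := hypDist x y
  have hS : 0 < sinh ρ := sinh_pos_iff.2 h0
  -- Geodesic interpolation on the hyperboloid: if `X`, `Y` lift `x`, `y`, the point sought is `α X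
  -- + β Y`. `e1` and `e2` are its Lorentz products with `X` and `Y`, up to sign, and `e3` puts it
  -- on the hyperboloid.
  obtain ⟨α, hα⟩ : ∃ α, α = sinh (ρ - d) / sinh ρ := ⟨_, rfl⟩
  obtain ⟨β, hβ⟩ : ∃ β, β = sinh d / sinh ρ := ⟨_, rfl⟩
  have hα0 : 0 ≤ α := by
    rw [hα]; exact div_nonneg (sinh_nonneg_iff.2 (by linarith)) hS.le
  have hβ0 : 0 ≤ β := by rw [hβ]; exact div_nonneg (sinh_nonneg_iff.2 hd) hS.le
  have e1 : α + β * cosh ρ = cosh d := by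
    rw [hα, hβ, sinh_sub]; field_simp; ring
  have e2 : α * cosh ρ + β = cosh (ρ - d) := by
    rw [hα, hβ, sinh_sub, cosh_sub]; field_simp
    linear_combination (-sinh d) * cosh_sq ρ
  have e3 : α ^ 2 + β ^ 2 + 2 * α * β * cosh ρ = 1 := by
    calc α ^ 2 + β ^ 2 + 2 * α * β * cosh ρ = α * (α + β * cosh ρ) + β * (α * cosh ρ + β) := by ring
      _ = α * cosh d + β * cosh (ρ - d) := by rw [e1, e2]
      _ = (sinh (ρ - d) * cosh d + cosh (ρ - d) * sinh d) / sinh ρ := by rw [hα, hβ]; ring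
      _ = 1 := by rw [← sinh_add, sub_add_cancel, div_self hS.ne']
  have hinner : inner ℝ x y = ((1 + ‖x‖ ^ 2) * (1 + ‖y‖ ^ 2)
      - cosh ρ * ((1 - ‖x‖ ^ 2) * (1 - ‖y‖ ^ 2))) / 4 := by
    rw [hK, div_mul_cancel₀ _ (mul_pos ha hb).ne']; ring
  obtain ⟨p₀, hp₀⟩ : ∃ p₀, p₀ = α * ((1 + ‖x‖ ^ 2) / (1 - ‖x‖ ^ 2))
    + β * ((1 + ‖y‖ ^ 2) / (1 - ‖y‖ ^ 2)) := ⟨_, rfl⟩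
  obtain ⟨p, hp⟩ : ∃ p, p = (2 * α / (1 - ‖x‖ ^ 2)) • x + (2 * β / (1 - ‖y‖ ^ 2)) • y := ⟨_, rfl⟩
  have hpx : inner ℝ x p = 2 * α / (1 - ‖x‖ ^ 2) * ‖x‖ ^ 2
      + 2 * β / (1 - ‖y‖ ^ 2) * inner ℝ x y := by
    rw [hp, inner_add_right, real_inner_smul_right, real_inner_smul_right,
      real_inner_self_eq_norm_sq]
  have hpy : inner ℝ y p = 2 * α / (1 - ‖x‖ ^ 2) * inner ℝ x y
      + 2 * β / (1 - ‖y‖ ^ 2) * ‖y‖ ^ 2 := by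
    rw [hp, inner_add_right, real_inner_smul_right, real_inner_smul_right,
      real_inner_self_eq_norm_sq, real_inner_comm]
  have hpp : ‖p‖ ^ 2 = 2 * α / (1 - ‖x‖ ^ 2) * inner ℝ x p
      + 2 * β / (1 - ‖y‖ ^ 2) * inner ℝ y p := by
    rw [← real_inner_self_eq_norm_sq, ← real_inner_smul_left, ← real_inner_smul_left,
      ← inner_add_left, ← hp]
  have hcx : ((1 + ‖x‖ ^ 2) * p₀ - 2 * inner ℝ x p) / (1 - ‖x‖ ^ 2) = α + β * cosh ρ := by
    rw [hpx, hp₀, hinner]; field_simp; ring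
  have hcy : ((1 + ‖y‖ ^ 2) * p₀ - 2 * inner ℝ y p) / (1 - ‖y‖ ^ 2) = α * cosh ρ + β := by
    rw [hpy, hp₀, hinner]; field_simp; ring
  have hq : p₀ ^ 2 - ‖p‖ ^ 2 = 1 := by
    calc p₀ ^ 2 - ‖p‖ ^ 2
        = α * (((1 + ‖x‖ ^ 2) * p₀ - 2 * inner ℝ x p) / (1 - ‖x‖ ^ 2))
          + β * (((1 + ‖y‖ ^ 2) * p₀ - 2 * inner ℝ y p) / (1 - ‖y‖ ^ 2)) := by
            rw [hpp, pow_two p₀]; nth_rewrite 1 [hp₀]; ring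
      _ = 1 := by rw [hcx, hcy, ← e3]; ring
  have hp₀pos : 0 < p₀ := by
    have : 0 ≤ p₀ := by rw [hp₀]; positivity
    refine this.lt_of_ne fun h ↦ ?_
    rw [← h] at hq
    nlinarith [sq_nonneg ‖p‖]
  obtain ⟨hmem, hcosh⟩ := inv_smul_mem_ball_and_cosh_hypDist hp₀pos hq
  refine ⟨_, hmem, eq_hypDist_of_cosh_eq hd ?_, ?_⟩
  · rw [hcosh x hx, hcx, e1]
  · rw [hypDist_comm]
    exact eq_hypDist_of_cosh_eq (by linarith) (by rw [hcosh y hy, hcy, e2])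

/-- Hyperbolic balls are contained in Euclidean balls that are relatively small in the unit
ball. -/
theorem exists_forall_hypDist_le_mem_closedBall (hm : m ∈ ball 0 1) {s : ℝ} (hs : 0 < s)
    (hs1 : s < 1) :
    ∃ c ∈ ball (0 : EuclideanSpace ℝ (Fin n)) 1, ∀ x ∈ ball (0 : EuclideanSpace ℝ (Fin n)) 1,
      hypDist x m ≤ artanh s → x ∈ closedBall c (s * (1 - ‖c‖)) := by
  obtain ⟨T, hT⟩ : ∃ T, T = sinh (artanh s / 2) ^ 2 := ⟨_, rfl⟩
  have hT0 : 0 ≤ T := by rw [hT]; positivity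
  have hsT : 4 * T * (1 + T) = s ^ 2 * (1 + 2 * T) ^ 2 := by
    have h1 : cosh (artanh s) = 1 + 2 * T := by
      rw [hT, cosh_eq_one_add_two_mul_sinh_half_sq]
    have hs' : 0 < 1 - s ^ 2 := by nlinarith
    rw [cosh_artanh ⟨by linarith, hs1⟩] at h1
    have h2 : (1 + 2 * T) ^ 2 * (1 - s ^ 2) = 1 := by
      rw [← h1, div_pow, sq_sqrt hs'.le]; field_simp
    linarith
  have hm' := one_sub_norm_sq_pos hm
  rw [mem_ball_zero_iff] at hm
  have ha := norm_nonneg m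
  set a := ‖m‖ with ha_def
  -- Completing the square in `‖x - m‖² ≤ T (1 - ‖x‖²)(1 - a²)` gives a Euclidean ball of centre
  -- `A⁻¹ • m`.
  obtain ⟨A, hA⟩ : ∃ A, A = 1 + T * (1 - a ^ 2) := ⟨_, rfl⟩
  have hA1 : 1 ≤ A := by rw [hA]; nlinarith
  have hnorm : ‖A⁻¹ • m‖ = a / A := by
    rw [norm_smul, norm_inv, Real.norm_of_nonneg (by linarith), inv_mul_eq_div]
  refine ⟨A⁻¹ • m, ?_, fun x hx hxm ↦ ?_⟩
  · rw [mem_ball_zero_iff, hnorm, div_lt_one (by linarith)]; linarith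
  have hx' := one_sub_norm_sq_pos hx
  have h1 : ‖x - m‖ ^ 2 ≤ T * ((1 - ‖x‖ ^ 2) * (1 - a ^ 2)) := by
    rw [← div_le_iff₀ (mul_pos hx' hm'), ← sinh_sq_half_hypDist hx (by simpa using hm), hT]
    have := hypDist_nonneg x m
    exact pow_le_pow_left₀ (sinh_nonneg_iff.2 (by linarith)) (sinh_le_sinh.2 (by linarith)) 2
  rw [norm_sub_sq_real] at h1
  have h2 : ‖A • x - m‖ ^ 2 ≤ (s * (A - a)) ^ 2 := by
    have e1 : ‖A • x - m‖ ^ 2 = A ^ 2 * ‖x‖ ^ 2 - 2 * A * inner ℝ x m + a ^ 2 := by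
      rw [norm_sub_sq_real, norm_smul, real_inner_smul_left, mul_pow, Real.norm_eq_abs, sq_abs]
      ring
    have e2 : ‖A • x - m‖ ^ 2 ≤ (1 - a ^ 2) ^ 2 * (T * (1 + T)) := by
      rw [e1]
      have h3 : A * ‖x‖ ^ 2 - 2 * inner ℝ x m + a ^ 2 - T * (1 - a ^ 2) ≤ 0 := by
        rw [hA]; linarith
      have h4 := mul_nonpos_of_nonneg_of_nonpos (by linarith : 0 ≤ A) h3
      have h5 : (1 - a ^ 2) ^ 2 * (T * (1 + T)) = a ^ 2 - A * (a ^ 2 - T * (1 - a ^ 2)) := by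
        rw [hA]; ring
      rw [h5]; linarith
    have e3 : A - a = (1 - a) * (1 + T * (1 + a)) := by rw [hA]; ring
    -- Before squaring this reduces to `a ≤ 1`.
    have e4 : ((1 + a) * (1 + 2 * T)) ^ 2 ≤ (2 * (1 + T * (1 + a))) ^ 2 := by
      refine pow_le_pow_left₀ (by positivity) ?_ 2
      linarith
    calc ‖A • x - m‖ ^ 2 ≤ (1 - a ^ 2) ^ 2 * (T * (1 + T)) := e2
      _ = (s * (1 - a)) ^ 2 / 4 * ((1 + a) * (1 + 2 * T)) ^ 2 := by
        rw [show T * (1 + T) = s ^ 2 * (1 + 2 * T) ^ 2 / 4 by linarith]; ring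
      _ ≤ (s * (1 - a)) ^ 2 / 4 * (2 * (1 + T * (1 + a))) ^ 2 := by gcongr
      _ = (s * (A - a)) ^ 2 := by rw [e3]; ring
  have hA0 : 0 < A := by linarith
  have h3 : ‖A • x - m‖ ≤ s * (A - a) :=
    le_of_sq_le_sq h2 (mul_nonneg hs.le (by linarith))
  rw [mem_closedBall, dist_eq_norm, hnorm]
  have h4 : x - A⁻¹ • m = A⁻¹ • (A • x - m) := by
    rw [smul_sub, smul_smul, inv_mul_cancel₀ hA0.ne', one_smul]
  rw [h4, norm_smul, norm_inv, Real.norm_of_nonneg hA0.le, inv_mul_le_iff₀ hA0]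
  calc ‖A • x - m‖ ≤ s * (A - a) := h3
    _ = A * (s * (1 - a / A)) := by field_simp

/-- Points whose Euclidean distance is a given proportion of the distance to the boundary are not
hyperbolically close. -/
theorem lt_exp_hypDist_sub_one (hx : x ∈ ball 0 1) {s : ℝ} (hs : 0 < s) (hs1 : s < 1)
    (hy : y ∈ sphere x (s * (1 - ‖x‖))) : s < exp (hypDist x y) - 1 := by
  have hx' := one_sub_norm_sq_pos hx
  rw [mem_ball_zero_iff] at hx
  rw [mem_sphere, dist_eq_norm, norm_sub_rev] at hy
  have ha := norm_nonneg x
  have hle1 : ‖y‖ ≤ ‖x‖ + s * (1 - ‖x‖) := by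
    rw [← hy, norm_sub_rev]; linarith [norm_le_norm_add_norm_sub' y x]
  have hle2 : ‖x‖ - s * (1 - ‖x‖) ≤ ‖y‖ := by
    rw [← hy]; linarith [norm_le_norm_add_norm_sub' x y]
  have hle3 : s * (1 - ‖x‖) - ‖x‖ ≤ ‖y‖ := by
    rw [← hy]; linarith [norm_sub_le x y]
  have hyb : y ∈ ball (0 : EuclideanSpace ℝ (Fin n)) 1 := by
    rw [mem_ball_zero_iff]; nlinarith
  have hy' := one_sub_norm_sq_pos hyb
  -- The left side is `sinh (log (1 + s) / 2) ^ 2`.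
  have key : s ^ 2 / (4 * (1 + s)) < sinh (hypDist x y / 2) ^ 2 := by
    rw [sinh_sq_half_hypDist (by simpa using hx) hyb, hy,
      div_lt_div_iff₀ (by linarith) (mul_pos hx' hy')]
    have h1 : 1 - ‖y‖ ^ 2 ≤ (1 - ‖x‖) * (1 + s) * (1 + (‖x‖ - s * (1 - ‖x‖))) := by
      have : (‖x‖ - s * (1 - ‖x‖)) ^ 2 ≤ ‖y‖ ^ 2 := sq_le_sq' (by linarith) hle2
      linarith
    have h2 : (1 + ‖x‖) * (1 + (‖x‖ - s * (1 - ‖x‖))) < 4 := by nlinarith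
    have h3 : 0 < s ^ 2 * (1 - ‖x‖) ^ 2 * (1 + s) := by
      have : 0 < 1 - ‖x‖ := by linarith
      positivity
    calc s ^ 2 * ((1 - ‖x‖ ^ 2) * (1 - ‖y‖ ^ 2))
        ≤ s ^ 2 * ((1 - ‖x‖ ^ 2) * ((1 - ‖x‖) * (1 + s) * (1 + (‖x‖ - s * (1 - ‖x‖))))) := by
          gcongr
      _ = s ^ 2 * (1 - ‖x‖) ^ 2 * (1 + s) * ((1 + ‖x‖) * (1 + (‖x‖ - s * (1 - ‖x‖)))) := by ring
      _ < s ^ 2 * (1 - ‖x‖) ^ 2 * (1 + s) * 4 := by gcongr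
      _ = (s * (1 - ‖x‖)) ^ 2 * (4 * (1 + s)) := by ring
  have h0 := hypDist_nonneg x y
  have hc : cosh (log (1 + s)) < cosh (hypDist x y) := by
    have h3 : cosh (log (1 + s)) = 1 + 2 * (s ^ 2 / (4 * (1 + s))) := by
      rw [cosh_log (by linarith)]; field_simp; ring
    rw [cosh_eq_one_add_two_mul_sinh_half_sq (hypDist x y), h3]; linarith
  rw [cosh_lt_cosh, abs_of_nonneg h0, abs_of_nonneg (log_nonneg (by linarith))] at hc
  have := exp_lt_exp.2 hc
  rw [exp_log (by linarith)] at this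
  linarith

end HyperbolicDistance

/-! ### Harnack chains along hyperbolic geodesics. -/

section HarnackChain

open Real

variable {n : ℕ} {s C : ℝ} {u : EuclideanSpace ℝ (Fin n) → ℝ}

theorem SatisfiesHarnack.le_mul_of_mem_closedBall {G : Set (EuclideanSpace ℝ (Fin n))}
    (hu : SatisfiesHarnack G s C u) (hs1 : s < 1) (hC : 0 ≤ C) {c x y : EuclideanSpace ℝ (Fin n)}
    {δ : ℝ} (hδ : 0 < δ) (hG : ball c δ ⊆ G) (hx : x ∈ closedBall c (s * δ))
    (hy : y ∈ closedBall c (s * δ)) : u x ≤ C * u y := by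
  have hsub : closedBall c (s * δ) ⊆ G := (closedBall_subset_ball (by nlinarith)).trans hG
  have hcomp := (isCompact_closedBall c (s * δ)).image_of_continuousOn (hu.continuousOn.mono hsub)
  calc u x ≤ sSup (u '' closedBall c (s * δ)) := le_csSup hcomp.bddAbove ⟨x, hx, rfl⟩
    _ ≤ C * sInf (u '' closedBall c (s * δ)) := hu.sSup_le c δ hδ hG
    _ ≤ C * u y := mul_le_mul_of_nonneg_left (csInf_le hcomp.bddBelow ⟨y, hy, rfl⟩) hC

variable {x y : EuclideanSpace ℝ (Fin n)}

theorem SatisfiesHarnack.le_mul_of_hypDist_le (hu : SatisfiesHarnack (ball 0 1) s C u)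
    (hs : 0 < s) (hs1 : s < 1) (hC : 0 ≤ C) (hx : x ∈ ball 0 1) (hy : y ∈ ball 0 1)
    (h : hypDist x y ≤ 2 * artanh s) : u x ≤ C * u y := by
  have h0 := hypDist_nonneg x y
  obtain ⟨m, hm, hxm, hmy⟩ := exists_hypDist_eq_and_hypDist_eq_sub hx hy
    (d := hypDist x y / 2) (by linarith) (by linarith)
  obtain ⟨c, hc, hball⟩ := exists_forall_hypDist_le_mem_closedBall hm hs hs1
  have hc' := hc
  rw [mem_ball_zero_iff] at hc'
  refine hu.le_mul_of_mem_closedBall hs1 hC (c := c) (δ := 1 - ‖c‖) (by linarith)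
    (ball_subset_ball' (by rw [dist_zero_right]; linarith))
    (hball x hx (by linarith)) (hball y hy (by rw [hypDist_comm]; linarith))

theorem SatisfiesHarnack.le_pow_mul_of_hypDist_le (hu : SatisfiesHarnack (ball 0 1) s C u)
    (hs : 0 < s) (hs1 : s < 1) (hC : 0 ≤ C) (k : ℕ) (hx : x ∈ ball 0 1) (hy : y ∈ ball 0 1)
    (h : hypDist x y ≤ k * (2 * artanh s)) : u x ≤ C ^ k * u y := by
  have hL : 0 ≤ 2 * artanh s := by linarith [artanh_nonneg hs.le]
  induction k generalizing x with
  | zero =>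
    rw [eq_of_hypDist_eq_zero hx hy (le_antisymm (by simpa using h) (hypDist_nonneg x y))]
    simp
  | succ k ih =>
    -- A full step of length `2 * artanh s`, or a jump straight to `y` if it is nearer.
    obtain ⟨z, hz, hxz, hzy⟩ := exists_hypDist_eq_and_hypDist_eq_sub hx hy
      (d := min (2 * artanh s) (hypDist x y)) (le_min hL (hypDist_nonneg x y)) (min_le_right _ _)
    have h1 := hu.le_mul_of_hypDist_le hs hs1 hC hx hz (hxz.le.trans (min_le_left _ _))
    have h2 := ih hz (by
      rw [hzy]
      push_cast at h
      have hk : 0 ≤ (k : ℝ) * (2 * artanh s) := by positivity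
      rcases min_choice (2 * artanh s) (hypDist x y) with h' | h' <;> rw [h'] <;> linarith)
    calc u x ≤ C * u z := h1
      _ ≤ C * (C ^ k * u y) := mul_le_mul_of_nonneg_left h2 hC
      _ = C ^ (k + 1) * u y := by ring

theorem log_one_add_div_one_sub {r : ℝ} (h1 : -1 < r) (h2 : r < 1) :
    log ((1 + r) / (1 - r)) = 2 * artanh r := by
  rw [artanh_eq_half_log ⟨h1.le, h2.le⟩]; ring

theorem SatisfiesHarnack.le_rpow_mul (hu : SatisfiesHarnack (ball 0 1) s C u)
    (hs : 0 < s) (hs1 : s < 1) (hC : 1 ≤ C) (hx : x ∈ ball 0 1) (hy : y ∈ ball 0 1) :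
    u x ≤ C ^ (1 + hypDist x y / (2 * artanh s)) * u y := by
  have hL : 0 < 2 * artanh s := by linarith [artanh_pos ⟨hs, hs1⟩]
  have ht : 0 ≤ hypDist x y / (2 * artanh s) := div_nonneg (hypDist_nonneg x y) hL.le
  refine (hu.le_pow_mul_of_hypDist_le hs hs1 (by linarith)
    ⌈hypDist x y / (2 * artanh s)⌉₊ hx hy ?_).trans ?_
  · rw [← div_le_iff₀ hL]; exact Nat.le_ceil _
  · refine mul_le_mul_of_nonneg_right ?_ (hu.nonneg y hy)
    rw [← rpow_natCast]
    exact rpow_le_rpow_of_exponent_le hC (by linarith [Nat.ceil_lt_add_one ht])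

end HarnackChain

theorem mainTheorem9 (n : ℕ) (hn : 2 ≤ n) :
    (∀ (s C : ℝ) (u : EuclideanSpace ℝ (Fin n) → ℝ), 0 < s → s < 1 → 1 ≤ C →
      (∀ x ∈ Metric.ball (0 : EuclideanSpace ℝ (Fin n)) 1, 0 < u x) →
      SatisfiesHarnack (Metric.ball (0 : EuclideanSpace ℝ (Fin n)) 1) s C u →
      ∀ x ∈ Metric.ball (0 : EuclideanSpace ℝ (Fin n)) 1,
      ∀ y ∈ Metric.ball (0 : EuclideanSpace ℝ (Fin n)) 1,
      ∀ r t : ℝ, r = Real.tanh (hypDist x y / 2) →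
        t = Real.log ((1 + r) / (1 - r)) / Real.log ((1 + s) / (1 - s)) →
        u x ≤ C ^ (1 + t) * u y) ∧
    (∀ u : EuclideanSpace ℝ (Fin n) → ℝ,
      InnerProductSpace.HarmonicOnNhd u (Metric.ball (0 : EuclideanSpace ℝ (Fin n)) 1) →
      (∀ x ∈ Metric.ball (0 : EuclideanSpace ℝ (Fin n)) 1, 0 < u x) →
      ∀ x ∈ Metric.ball (0 : EuclideanSpace ℝ (Fin n)) 1, ∀ s : ℝ, 0 < s → s < 1 →
      ∀ y ∈ Metric.sphere x (s * (1 - ‖x‖)),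
        u x ≤ 1 / (1 - s ^ 2) * ((1 + s) / (1 - s)) ^ n * u y ∧
        s < Real.exp (hypDist x y) - 1) := by
  refine ⟨?_, ?_⟩
  · rintro s C u hs hs1 hC - hu x hx y hy r t hr rfl
    have hr' := Real.tanh_bijOn.mapsTo (Set.mem_univ (hypDist x y / 2))
    rw [← hr] at hr'
    rw [log_one_add_div_one_sub hr'.1 hr'.2, log_one_add_div_one_sub (by linarith) hs1, hr,
      Real.artanh_tanh, mul_div_cancel₀ _ (two_ne_zero' ℝ)]
    exact hu.le_rpow_mul hs hs1 hC hx hy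
  · intro u hu hpos x hx s hs hs1 y hy
    refine ⟨?_, lt_exp_hypDist_sub_one hx hs hs1 hy⟩
    have hxn : ‖x‖ < 1 := by simpa using hx
    have hsub : ball x (1 - ‖x‖) ⊆ ball (0 : EuclideanSpace ℝ (Fin n)) 1 :=
      ball_subset_ball' (by rw [dist_zero_right]; linarith)
    have hR : 0 < 1 - ‖x‖ := by linarith
    have h := HarmonicOnNhd.one_sub_pow_mul_le (hu.mono hsub) (fun z hz ↦ (hpos z (hsub hz)).le)
      hR hs.le hs1 (mem_sphere.1 hy)
    rw [finrank_euclideanSpace_fin] at h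
    have hyb : y ∈ ball (0 : EuclideanSpace ℝ (Fin n)) 1 :=
      hsub (by rw [mem_ball, mem_sphere.1 hy]; nlinarith)
    have h1s : 0 < 1 - s := by linarith
    have hpow : 0 < (1 - s) ^ (n + 1) := pow_pos h1s _
    obtain ⟨k, rfl⟩ : ∃ k, n = k + 1 := ⟨n - 1, by omega⟩
    calc u x ≤ 1 / (1 - s) ^ (k + 1 + 1) * u y := by
          rw [one_div, ← div_eq_inv_mul, le_div_iff₀ hpow]; linarith
      -- With `n = k + 1` the claimed constant equals `(1 + s) ^ (n - 1) / (1 - s) ^ (n + 1)`, so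
      -- inserting `(1 + s) ^ k ≥ 1` is enough.
      _ ≤ (1 + s) ^ k / (1 - s) ^ (k + 1 + 1) * u y := by
          have := one_le_pow₀ (by linarith : 1 ≤ 1 + s) (n := k)
          have := (hpos y hyb).le
          gcongr
      _ = 1 / (1 - s ^ 2) * ((1 + s) / (1 - s)) ^ (k + 1) * u y := by
          have h1 : 1 - s ^ 2 = (1 - s) * (1 + s) := by ring
          have h2 : 0 < 1 + s := by linarith
          rw [h1, div_pow]
          field_simp
          ring
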